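/- \textbf{Setting.} Consider a stochastic bandit with $K\ge 2$ arms, mean vector $\theta=(\theta_1,\dots,\theta_K)\in[0,1]^K$ and Gaussian noise: in each round $t=1,2,\dots$ an arm $a_t$ is pulled and the reward $\theta_{a_t}+\varepsilon_t$ is observed, with $\varepsilon_t\sim\mathcal N(0,\sigma^2)$ independent of the past and of $a_t$, where $\sigma>0$ is fixed. An \emph{any-time} policy draws $a_t$ from a probability distribution on the arms that depends only on the arms pulled and rewards observed in rounds $1,\dots,t-1$. A \emph{fixed-time} policy $\pi$ is a sequence $\pi(1),\pi(2),\dots$ of such policies, where $\pi(T)$ is executed when the horizon is $T$ (so $T$ is known); an any-time policy $\pi$ is regarded as the fixed-time policy with $\pi(T)=\pi$ for all $T$ (so $T$ is unknown). Let $\theta_*=\max_k\theta_k$, let $n_k$ be the number of pulls of arm $k$ in the first $T$ rounds, and let $R^\pi_\theta(T)=\sum_{k=1}^K n_k(\theta_*-\theta_k)$ be the pseudo regret under $\pi(T)$. All suprema over $\theta$ are over $[0,1]^K$, and $\ln 0=-\infty$. \textbf{Definitions.} A policy $\pi$ is - \emph{$\alpha$-optimal} if $\limsup_{T\to\infty}\sup_\theta\mathbb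 E[R^\pi_\theta(T)]/T^{\alpha'}=0$ for every $\alpha'>\alpha$; - \emph{$\beta$-consistent} if $\limsup_{T\to\infty}\mathbb E[R^\pi_\theta(T)]/T^{\beta'}=0$ for every $\theta\in[0,1]^K$ and every $\beta'>\beta$; - \emph{worst-case $(\delta,\gamma)$-tailed} if there are constants $c\in(0,1/2)$ and $C>0$ with $\limsup_{T\to\infty}T^{-\gamma}\ln\sup_\theta\mathbb P(R^\pi_\theta(T)>cT^\delta)\le -C$; - \emph{instance-dependent $(\delta,\gamma)$-tailed} if for every $\theta\in[0,1]^K$ there are constants $c\in(0,1/2)$ and $C>0$ with $\limsup_{T\to\infty}T^{-\gamma}\ln\mathbb P(R^\pi_\theta(T)>cT^\delta)\le -C$. \textbf{Proposition.} 1. Let $\alpha\in[1/2,1)$. If a fixed-time policy $\pi$ is $\alpha$-optimal, then for all $\delta\in(\alpha,1]$ and $\gamma>\delta+\alpha-1$, $\pi$ is not worst-case $(\delta,\gamma)$-tailed. 2. Let $\beta\in[0,1)$. (a) If a fixed-time policy $\pi$ is $\beta$-consistent, then for all $\delta\in(\beta,1]$ and $\gamma>\beta$, $\pi$ is not instance-dependent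 $(\delta,\gamma)$-tailed. (b) If an any-time policy $\pi$ is $\beta$-consistent, then for all $\delta\in(\beta,1]$ and $\gamma>\delta\beta$, $\pi$ is not instance-dependent $(\delta,\gamma)$-tailed. -/

import Mathlib

open MeasureTheory ProbabilityTheory Filter
open scoped NNReal ENNReal

namespace Bandit

/-- A history of `t` completed rounds of a `K`-armed bandit: the pulled arm and the observed reward
of every round. -/
abbrev History (K t : ℕ) : Type := Fin t → Fin K × ℝ

/-- An any-time (randomized) policy: after `t` completed rounds, the next arm is drawn from the
discrete distribution `step t h` on the arms, which depends on the history `h` only. -/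
structure AnyTimePolicy (K : ℕ) where
  step : (t : ℕ) → Kernel (History K t) (Fin K)
  isMarkov : ∀ t, IsMarkovKernel (step t)

attribute [instance] AnyTimePolicy.isMarkov

/-- A fixed-time policy: for every horizon `T` a sub-policy `π T`, which is the one executed when
the horizon is `T`. (What `π T` prescribes after round `T` is never used.) -/
abbrev FixedTimePolicy (K : ℕ) : Type := ℕ → AnyTimePolicy K

/-- An any-time policy is the fixed-time policy that uses the same sub-policy for all horizons. -/
def AnyTimePolicy.toFixedTime {K : ℕ} (π : AnyTimePolicy K) : FixedTimePolicy K := fun _ => π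

noncomputable section

/-- The reward of arm `k` is `θ k + ε` with `ε ∼ N(0, σ²)`. -/
def rewardKernel {K : ℕ} (σ : ℝ≥0) (θ : Fin K → ℝ) : Kernel (Fin K) ℝ where
  toFun k := gaussianReal (θ k) (σ ^ 2)
  measurable' := measurable_of_countable _

instance {K : ℕ} (σ : ℝ≥0) (θ : Fin K → ℝ) : IsMarkovKernel (rewardKernel σ θ) :=
  ⟨fun k => inferInstanceAs (IsProbabilityMeasure (gaussianReal (θ k) (σ ^ 2)))⟩

/-- One round: draw an arm from the policy given the history, then a reward given that arm. -/
def roundKernel {K : ℕ} (σ : ℝ≥0) (θ : Fin K → ℝ) (π : AnyTimePolicy K) (t : ℕ) :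
    Kernel (History K t) (Fin K × ℝ) :=
  π.step t ⊗ₖ Kernel.prodMkLeft (History K t) (rewardKernel σ θ)

instance {K : ℕ} (σ : ℝ≥0) (θ : Fin K → ℝ) (π : AnyTimePolicy K) (t : ℕ) :
    IsMarkovKernel (roundKernel σ θ π t) := by
  unfold roundKernel; infer_instance

/-- The law of the history of the first `t` rounds when the policy `π` faces the Gaussian bandit
with mean vector `θ` and noise level `σ`. -/
def historyLaw {K : ℕ} (σ : ℝ≥0) (θ : Fin K → ℝ) (π : AnyTimePolicy K) :
    (t : ℕ) → Measure (History K t)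
  | 0 => Measure.dirac Fin.elim0
  | t + 1 => (historyLaw σ θ π t ⊗ₘ roundKernel σ θ π t).map
      fun p => (Fin.snoc p.1 p.2 : History K (t + 1))

theorem measurable_snoc {K t : ℕ} :
    Measurable fun p : History K t × (Fin K × ℝ) => (Fin.snoc p.1 p.2 : History K (t + 1)) := by
  refine measurable_pi_iff.2 fun i => ?_
  refine Fin.lastCases ?_ (fun j => ?_) i
  · simpa using measurable_snd
  · simpa [Function.comp_def] using (measurable_pi_apply j).comp measurable_fst

instance isProbabilityMeasure_historyLaw {K : ℕ} (σ : ℝ≥0) (θ : Fin K → ℝ)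
    (π : AnyTimePolicy K) (t : ℕ) : IsProbabilityMeasure (historyLaw σ θ π t) := by
  induction t with
  | zero => unfold historyLaw; infer_instance
  | succ t ih =>
    unfold historyLaw
    exact Measure.isProbabilityMeasure_map measurable_snoc.aemeasurable

/-- The number of pulls `n_k` of the arm `k` in a history. -/
def pulls {K T : ℕ} (h : History K T) (k : Fin K) : ℕ :=
  (Finset.univ.filter fun s : Fin T => (h s).1 = k).card

/-- The gap `Δ_k = θ_* - θ_k`, where `θ_*` is the largest mean. -/
def gap {K : ℕ} (θ : Fin K → ℝ) (k : Fin K) : ℝ := (⨆ j, θ j) - θ k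

/-- The pseudo regret `∑_k n_k Δ_k` of a history. -/
def pseudoRegret {K T : ℕ} (θ : Fin K → ℝ) (h : History K T) : ℝ :=
  ∑ k, (pulls h k : ℝ) * gap θ k

/-- `𝔼[R_θ^π(T)]`, as an extended nonnegative real (the pseudo regret is nonnegative). -/
def expectedRegret {K : ℕ} (σ : ℝ≥0) (π : FixedTimePolicy K) (θ : Fin K → ℝ) (T : ℕ) : ℝ≥0∞ :=
  ∫⁻ h, ENNReal.ofReal (pseudoRegret θ h) ∂(historyLaw σ θ (π T) T)

/-- `ℙ(R_θ^π(T) > x)`. -/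
def regretTail {K : ℕ} (σ : ℝ≥0) (π : FixedTimePolicy K) (θ : Fin K → ℝ) (T : ℕ) (x : ℝ) : ℝ≥0∞ :=
  historyLaw σ θ (π T) T {h | x < pseudoRegret θ h}

/-- The admissible mean vectors `θ ∈ [0, 1]^K`. -/
def meanVectors (K : ℕ) : Set (Fin K → ℝ) := Set.Icc 0 1

/-- Worst-case `α`-optimality. -/
def IsOptimal {K : ℕ} (σ : ℝ≥0) (α : ℝ) (π : FixedTimePolicy K) : Prop :=
  ∀ α' : ℝ, α < α' →
    limsup (fun T : ℕ => (⨆ θ ∈ meanVectors K, expectedRegret σ π θ T) / (T : ℝ≥0∞) ^ α') atTop = 0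

/-- Instance-dependent `β`-consistency. -/
def IsConsistent {K : ℕ} (σ : ℝ≥0) (β : ℝ) (π : FixedTimePolicy K) : Prop :=
  ∀ θ ∈ meanVectors K, ∀ β' : ℝ, β < β' →
    limsup (fun T : ℕ => expectedRegret σ π θ T / (T : ℝ≥0∞) ^ β') atTop = 0

/-- Worst-case `(δ, γ)`-tailed policies; the logarithm is extended-real valued, `ln 0 = -∞`. -/
def IsWorstCaseTailed {K : ℕ} (σ : ℝ≥0) (δ γ : ℝ) (π : FixedTimePolicy K) : Prop :=
  ∃ c C : ℝ, 0 < c ∧ c < 1 / 2 ∧ 0 < C ∧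
    limsup (fun T : ℕ =>
      ENNReal.log (⨆ θ ∈ meanVectors K, regretTail σ π θ T (c * (T : ℝ) ^ δ)) /
        (((T : ℝ) ^ γ : ℝ) : EReal)) atTop ≤ ((-C : ℝ) : EReal)

/-- Instance-dependent `(δ, γ)`-tailed policies; the constants may depend on the mean vector. -/
def IsInstanceTailed {K : ℕ} (σ : ℝ≥0) (δ γ : ℝ) (π : FixedTimePolicy K) : Prop :=
  ∀ θ ∈ meanVectors K, ∃ c C : ℝ, 0 < c ∧ c < 1 / 2 ∧ 0 < C ∧
    limsup (fun T : ℕ =>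
      ENNReal.log (regretTail σ π θ T (c * (T : ℝ) ^ δ)) /
        (((T : ℝ) ^ γ : ℝ) : EReal)) atTop ≤ ((-C : ℝ) : EReal)

end

end Bandit

/-! ### Change of measure between Gaussian bandits. -/

namespace Bandit

/-! Small expected regret forces a policy to pull a losing arm `j` rarely, so it can hardly notice
when `j` becomes the best arm. Let arm `i` lead with mean `Δ`, all others having mean `0`. If the
expected regret is at most `B`, Markov gives at most `2B/Δ` pulls of `j` with probability at least
1/2. Raising `j` by `2Δ` leaves this event with probability at least `exp(-8ΔB/σ²)/4`
(`historyLaw_shift_ge`), and on it the regret is now at least `TΔ - 2B`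
(`historyLaw_pseudoRegret_ge`).

For the worst case take `Δ = T^(δ-1)/2` and `B = T^α'`: the exponent has order `T^(δ-1+α')`. For a
fixed instance take `Δ = 1/2` and `B = T^β'`: the exponent has order `T^β'`. An any-time policy can
be stopped at round `⌈T^δ⌉`, since regret only grows afterwards; this lowers the order to `T^(δβ')`.
-/

/-- The log-likelihood ratio of one round between the mean vectors `θ'` and `θ`. -/
noncomputable def logRatio {K : ℕ} (σ : ℝ≥0) (θ θ' : Fin K → ℝ) (x : Fin K × ℝ) : ℝ :=
  ((x.2 - θ x.1) ^ 2 - (x.2 - θ' x.1) ^ 2) / (2 * (σ : ℝ) ^ 2)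

/-- The likelihood ratio of a history between the mean vectors `θ'` and `θ`. -/
noncomputable def likelihood {K t : ℕ} (σ : ℝ≥0) (θ θ' : Fin K → ℝ) (h : History K t) : ℝ≥0∞ :=
  ENNReal.ofReal (Real.exp (∑ s, logRatio σ θ θ' (h s)))

theorem measurable_logRatio {K : ℕ} (σ : ℝ≥0) (θ θ' : Fin K → ℝ) :
    Measurable (logRatio σ θ θ') := by
  have h1 : Measurable fun x : Fin K × ℝ => θ x.1 :=
    (measurable_of_countable θ).comp measurable_fst
  have h2 : Measurable fun x : Fin K × ℝ => θ' x.1 :=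
    (measurable_of_countable θ').comp measurable_fst
  unfold logRatio
  fun_prop

theorem measurable_likelihood {K t : ℕ} (σ : ℝ≥0) (θ θ' : Fin K → ℝ) :
    Measurable (likelihood σ θ θ' : History K t → ℝ≥0∞) := by
  have := measurable_logRatio σ θ θ'
  unfold likelihood
  fun_prop

theorem likelihood_snoc {K t : ℕ} (σ : ℝ≥0) (θ θ' : Fin K → ℝ) (h : History K t)
    (x : Fin K × ℝ) :
    likelihood σ θ θ' (Fin.snoc h x : History K (t + 1)) =
      likelihood σ θ θ' h * ENNReal.ofReal (Real.exp (logRatio σ θ θ' x)) := by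
  unfold likelihood
  rw [Fin.sum_univ_castSucc, Real.exp_add, ENNReal.ofReal_mul (Real.exp_nonneg _)]
  simp

theorem gaussianReal_eq_withDensity (μ μ' : ℝ) {v : ℝ≥0} (hv : v ≠ 0) :
    gaussianReal μ' v = (gaussianReal μ v).withDensity
      fun x => ENNReal.ofReal (Real.exp (((x - μ) ^ 2 - (x - μ') ^ 2) / (2 * v))) := by
  rw [gaussianReal_of_var_ne_zero _ hv, gaussianReal_of_var_ne_zero _ hv,
    ← withDensity_mul _ (measurable_gaussianPDF _ _) (by fun_prop)]
  congr 1
  ext x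
  simp only [gaussianPDF, Pi.mul_apply]
  rw [← ENNReal.ofReal_mul (gaussianPDFReal_nonneg _ _ _)]
  simp only [gaussianPDFReal]
  rw [mul_assoc _ (Real.exp _), ← Real.exp_add]
  congr 3
  ring

theorem lintegral_rewardKernel {K : ℕ} {σ : ℝ≥0} (hσ : 0 < σ) (θ θ' : Fin K → ℝ) (k : Fin K)
    {f : ℝ → ℝ≥0∞} (hf : Measurable f) :
    ∫⁻ r, f r ∂(rewardKernel σ θ' k) =
      ∫⁻ r, ENNReal.ofReal (Real.exp (logRatio σ θ θ' (k, r))) * f r ∂(rewardKernel σ θ k) := by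
  change ∫⁻ r, f r ∂(gaussianReal (θ' k) (σ ^ 2)) = ∫⁻ r, _ ∂(gaussianReal (θ k) (σ ^ 2))
  have hm := measurable_logRatio σ θ θ'
  rw [gaussianReal_eq_withDensity (θ k) (θ' k) (pow_ne_zero 2 hσ.ne'),
    lintegral_withDensity_eq_lintegral_mul _ (by fun_prop) hf]
  simp [logRatio]

theorem lintegral_historyLaw_succ {K : ℕ} (σ : ℝ≥0) (θ : Fin K → ℝ) (π : AnyTimePolicy K) (t : ℕ)
    {f : History K (t + 1) → ℝ≥0∞} (hf : Measurable f) :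
    ∫⁻ h, f h ∂(historyLaw σ θ π (t + 1)) =
      ∫⁻ h, ∫⁻ x, f (Fin.snoc h x : History K (t + 1)) ∂(roundKernel σ θ π t h)
        ∂(historyLaw σ θ π t) := by
  rw [historyLaw, lintegral_map hf measurable_snoc,
    Measure.lintegral_compProd (f := fun p => f (Fin.snoc p.1 p.2 : History K (t + 1)))
      (hf.comp measurable_snoc)]

theorem lintegral_roundKernel {K : ℕ} (σ : ℝ≥0) (θ : Fin K → ℝ) (π : AnyTimePolicy K) (t : ℕ)
    (h : History K t) {f : Fin K × ℝ → ℝ≥0∞} (hf : Measurable f) :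
    ∫⁻ x, f x ∂(roundKernel σ θ π t h) =
      ∫⁻ k, ∫⁻ r, f (k, r) ∂(rewardKernel σ θ k) ∂(π.step t h) := by
  rw [roundKernel, Kernel.lintegral_compProd _ _ _ hf]
  rfl

theorem lintegral_roundKernel_change {K : ℕ} {σ : ℝ≥0} (hσ : 0 < σ) (θ θ' : Fin K → ℝ)
    (π : AnyTimePolicy K) (t : ℕ) (h : History K t) {f : Fin K × ℝ → ℝ≥0∞} (hf : Measurable f) :
    ∫⁻ x, f x ∂(roundKernel σ θ' π t h) =
      ∫⁻ x, ENNReal.ofReal (Real.exp (logRatio σ θ θ' x)) * f x ∂(roundKernel σ θ π t h) := by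
  have hm := measurable_logRatio σ θ θ'
  rw [lintegral_roundKernel _ _ _ _ _ hf, lintegral_roundKernel _ _ _ _ _ (by fun_prop)]
  refine lintegral_congr fun k => ?_
  exact lintegral_rewardKernel hσ θ θ' k (by fun_prop)

/-- The arm choices follow the same kernels under both mean vectors, so only the reward densities
contribute; induction on the last round. -/
theorem lintegral_historyLaw_change {K : ℕ} {σ : ℝ≥0} (hσ : 0 < σ) (θ θ' : Fin K → ℝ)
    (π : AnyTimePolicy K) (t : ℕ) {f : History K t → ℝ≥0∞} (hf : Measurable f) :
    ∫⁻ h, f h ∂(historyLaw σ θ' π t) =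
      ∫⁻ h, likelihood σ θ θ' h * f h ∂(historyLaw σ θ π t) := by
  induction t with
  | zero => simp [historyLaw, likelihood]
  | succ t ih =>
    have hm := measurable_logRatio σ θ θ'
    have hf' : Measurable fun p : History K t × (Fin K × ℝ) =>
      f (Fin.snoc p.1 p.2 : History K (t + 1)) := hf.comp measurable_snoc
    rw [lintegral_historyLaw_succ _ _ _ _ hf,
      lintegral_historyLaw_succ (f := fun h => likelihood σ θ θ' h * f h) _ _ _ _
        ((measurable_likelihood σ θ θ').mul hf),
      ih hf'.lintegral_kernel_prod_right']
    refine lintegral_congr fun h => ?_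
    have hfh : Measurable fun x => f (Fin.snoc h x : History K (t + 1)) :=
      hf'.comp measurable_prodMk_left
    rw [lintegral_roundKernel_change hσ θ θ' π t h hfh, ← lintegral_const_mul _ (by fun_prop)]
    simp only [likelihood_snoc, mul_assoc]

theorem measurable_pulls {K T : ℕ} (k : Fin K) :
    Measurable fun h : History K T => pulls h k := by
  simp only [pulls, Finset.card_filter]
  refine Finset.measurable_sum _ fun s _ => ?_
  refine Measurable.ite ?_ measurable_const measurable_const
  exact (measurable_fst.comp (measurable_pi_apply s)) (measurableSet_singleton k)

theorem measurable_pseudoRegret {K T : ℕ} (θ : Fin K → ℝ) :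
    Measurable fun h : History K T => pseudoRegret θ h := by
  unfold pseudoRegret
  refine Finset.measurable_sum _ fun k _ => ?_
  exact ((measurable_of_countable (fun n : ℕ => (n : ℝ))).comp (measurable_pulls k)).mul_const _

theorem historyLaw_eq_setLIntegral {K : ℕ} {σ : ℝ≥0} (hσ : 0 < σ) (θ θ' : Fin K → ℝ)
    (π : AnyTimePolicy K) (t : ℕ) {A : Set (History K t)} (hA : MeasurableSet A) :
    historyLaw σ θ' π t A = ∫⁻ h in A, likelihood σ θ θ' h ∂(historyLaw σ θ π t) := by
  rw [← lintegral_indicator_one hA, lintegral_historyLaw_change hσ θ θ' π t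
    (measurable_one.indicator hA), ← lintegral_indicator hA]
  refine lintegral_congr fun h => ?_
  by_cases hh : h ∈ A <;> simp [hh]

/-- For opposite shifts the noise terms, linear in `d`, cancel. The product of the two likelihoods
therefore depends on the pull count alone. -/
theorem sum_logRatio_add {K t : ℕ} (σ : ℝ≥0) (θ : Fin K → ℝ) (k : Fin K) (d : ℝ)
    (h : History K t) :
    ∑ s, logRatio σ θ (θ + Pi.single k d) (h s) + ∑ s, logRatio σ θ (θ - Pi.single k d) (h s) =
      -(pulls h k * (d ^ 2 / (σ : ℝ) ^ 2)) := by
  rw [← Finset.sum_add_distrib, pulls, Finset.card_filter, Nat.cast_sum, Finset.sum_mul,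
    ← Finset.sum_neg_distrib]
  refine Finset.sum_congr rfl fun s _ => ?_
  by_cases hs : (h s).1 = k
  · simp only [logRatio, Pi.add_apply, Pi.sub_apply, hs, Pi.single_eq_same, if_true]
    push_cast
    ring
  · simp [logRatio, hs]

/-- If arm `k` is pulled at most `m` times with probability at least `1/2`, then the same event is
not too unlikely after a shift of the mean of arm `k`. -/
theorem historyLaw_shift_ge {K : ℕ} {σ : ℝ≥0} (hσ : 0 < σ) (θ : Fin K → ℝ) (k : Fin K) (d m : ℝ)
    (π : AnyTimePolicy K) (t : ℕ)
    (hP : (1 / 2 : ℝ) ≤ (historyLaw σ θ π t).real {h | (pulls h k : ℝ) ≤ m}) :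
    Real.exp (-(m * (d ^ 2 / (σ : ℝ) ^ 2))) / 4 ≤
      (historyLaw σ (θ + Pi.single k d) π t).real {h | (pulls h k : ℝ) ≤ m} := by
  set A : Set (History K t) := {h | (pulls h k : ℝ) ≤ m} with hAdef
  have hA : MeasurableSet A := measurableSet_le
    ((measurable_of_countable (fun n : ℕ => (n : ℝ))).comp (measurable_pulls k)) measurable_const
  set q : ℝ := m * (d ^ 2 / (σ : ℝ) ^ 2) with hq
  -- AM-GM: the two summands have product at least 1/4 on `A`. No concentration bound for the
  -- likelihood is needed.
  have hpt : ∀ h ∈ A, (1 : ℝ≥0∞) ≤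
      ENNReal.ofReal (Real.exp q) * likelihood σ θ (θ + Pi.single k d) h +
        ENNReal.ofReal (1 / 4) * likelihood σ θ (θ - Pi.single k d) h := by
    intro h hh
    have hsum := sum_logRatio_add σ θ k d h
    unfold likelihood
    set a := ∑ s, logRatio σ θ (θ + Pi.single k d) (h s)
    set b := ∑ s, logRatio σ θ (θ - Pi.single k d) (h s)
    rw [← ENNReal.ofReal_mul (Real.exp_nonneg _), ← ENNReal.ofReal_mul (by norm_num),
      ← ENNReal.ofReal_add (by positivity) (by positivity), ENNReal.one_le_ofReal,
      ← Real.exp_add]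
    have hle : (pulls h k : ℝ) * (d ^ 2 / (σ : ℝ) ^ 2) ≤ q :=
      mul_le_mul_of_nonneg_right hh (by positivity)
    have h1 : 1 ≤ Real.exp (q + a) * Real.exp b := by
      rw [← Real.exp_add]
      exact Real.one_le_exp (by linarith)
    nlinarith [sq_nonneg (Real.exp (q + a) - 1 / 4 * Real.exp b), Real.exp_pos (q + a),
      Real.exp_pos b]
  have hint : historyLaw σ θ π t A ≤
      ENNReal.ofReal (Real.exp q) * historyLaw σ (θ + Pi.single k d) π t A +
        ENNReal.ofReal (1 / 4) * historyLaw σ (θ - Pi.single k d) π t A := by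
    have hadd := historyLaw_eq_setLIntegral hσ θ (θ + Pi.single k d) π t hA
    have hsub := historyLaw_eq_setLIntegral hσ θ (θ - Pi.single k d) π t hA
    rw [hadd, hsub,
      ← lintegral_const_mul _ (measurable_likelihood _ _ _),
      ← lintegral_const_mul _ (measurable_likelihood _ _ _),
      ← lintegral_add_left ((measurable_likelihood _ _ _).const_mul _),
      ← setLIntegral_one (μ := historyLaw σ θ π t)]
    exact setLIntegral_mono' hA hpt
  have hreal : (historyLaw σ θ π t).real A ≤
      Real.exp q * (historyLaw σ (θ + Pi.single k d) π t).real A +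
        1 / 4 * (historyLaw σ (θ - Pi.single k d) π t).real A := by
    have := ENNReal.toReal_mono (by finiteness) hint
    rwa [ENNReal.toReal_add (by finiteness) (by finiteness), ENNReal.toReal_mul,
      ENNReal.toReal_mul, ENNReal.toReal_ofReal (Real.exp_nonneg _),
      ENNReal.toReal_ofReal (by norm_num)] at this
  -- The downward shift may leave the unit cube; only the trivial bound on its probability is used.
  -- The weight 1/4 then leaves 1/2 - 1/4 = 1/4.
  have hle1 : (historyLaw σ (θ - Pi.single k d) π t).real A ≤ 1 := measureReal_le_one
  rw [Real.exp_neg, div_le_iff₀ (by norm_num), inv_le_iff_one_le_mul₀ (Real.exp_pos q)]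
  linarith

/-! ### Regret after raising a rarely pulled arm. -/

theorem sum_pulls {K t : ℕ} (h : History K t) : ∑ k, pulls h k = t := by
  simpa [pulls] using (Finset.card_eq_sum_card_fiberwise (s := Finset.univ) (t := Finset.univ)
    (f := fun s : Fin t => (h s).1) (fun _ _ => Finset.mem_coe.2 (Finset.mem_univ _))).symm

theorem gap_nonneg {K : ℕ} (θ : Fin K → ℝ) (k : Fin K) : 0 ≤ gap θ k :=
  sub_nonneg.2 (le_ciSup (Set.finite_range θ).bddAbove k)

theorem sub_le_gap {K : ℕ} (θ : Fin K → ℝ) (j k : Fin K) : θ j - θ k ≤ gap θ k :=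
  sub_le_sub_right (le_ciSup (Set.finite_range θ).bddAbove j) _

theorem pulls_mul_gap_le_pseudoRegret {K t : ℕ} (θ : Fin K → ℝ) (h : History K t) (k : Fin K) :
    pulls h k * gap θ k ≤ pseudoRegret θ h :=
  Finset.single_le_sum (f := fun k => (pulls h k : ℝ) * gap θ k)
    (fun j _ => mul_nonneg (Nat.cast_nonneg _) (gap_nonneg θ j)) (Finset.mem_univ k)

theorem le_pseudoRegret_of_forall_ne {K t : ℕ} (θ : Fin K → ℝ) (h : History K t) (k : Fin K)
    {Δ : ℝ} (hΔ : ∀ j, j ≠ k → Δ ≤ gap θ j) : (t - pulls h k : ℝ) * Δ ≤ pseudoRegret θ h := by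
  have hs : (∑ j, (pulls h j : ℝ)) = t := by exact_mod_cast sum_pulls h
  rw [← hs, ← Finset.add_sum_erase _ _ (Finset.mem_univ k), add_sub_cancel_left, Finset.sum_mul,
    pseudoRegret, ← Finset.add_sum_erase _ _ (Finset.mem_univ k)]
  refine le_add_of_nonneg_of_le (mul_nonneg (Nat.cast_nonneg _) (gap_nonneg θ k)) ?_
  exact Finset.sum_le_sum fun j hj =>
    mul_le_mul_of_nonneg_left (hΔ j (Finset.ne_of_mem_erase hj)) (Nat.cast_nonneg _)

/-- If the expected regret is at most `B` when arm `i` leads by `Δ`, then the regret is large with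
a probability that is not too small once arm `j` is raised to lead by `Δ`. -/
theorem historyLaw_pseudoRegret_ge {K : ℕ} {σ : ℝ≥0} (hσ : 0 < σ) {i j : Fin K} (hij : i ≠ j)
    (π : AnyTimePolicy K) (t : ℕ) {Δ B x : ℝ} (hΔ : 0 < Δ) (hB : 0 < B)
    (hE : ∫⁻ h, ENNReal.ofReal (pseudoRegret (Pi.single i Δ) h)
      ∂(historyLaw σ (Pi.single i Δ) π t) ≤ ENNReal.ofReal B)
    (hx : x < t * Δ - 2 * B) :
    ENNReal.ofReal (Real.exp (-(8 * Δ * B / (σ : ℝ) ^ 2)) / 4) ≤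
      historyLaw σ (Pi.single i Δ + Pi.single j (2 * Δ)) π t
        {h | x < pseudoRegret (Pi.single i Δ + Pi.single j (2 * Δ)) h} := by
  set θ : Fin K → ℝ := Pi.single i Δ with hθ
  have hgap : Δ ≤ gap θ j := by
    have := sub_le_gap θ i j
    simpa [hθ, hij.symm] using this
  -- More than `2B/Δ` pulls of `j` cost more than `2B`, twice the bound on the mean, so Markov
  -- yields 1/2.
  have hcomp : {h : History K t | (pulls h j : ℝ) ≤ 2 * B / Δ}ᶜ ⊆
      {h | ENNReal.ofReal (2 * B) ≤ ENNReal.ofReal (pseudoRegret θ h)} := by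
    intro h hh
    refine ENNReal.ofReal_le_ofReal ?_
    have h1 : 2 * B / Δ < pulls h j := not_le.1 hh
    rw [div_lt_iff₀ hΔ] at h1
    have h2 := pulls_mul_gap_le_pseudoRegret θ h j
    nlinarith [mul_le_mul_of_nonneg_left hgap (Nat.cast_nonneg (α := ℝ) (pulls h j))]
  have hA : MeasurableSet {h : History K t | (pulls h j : ℝ) ≤ 2 * B / Δ} := measurableSet_le
    ((measurable_of_countable (fun n : ℕ => (n : ℝ))).comp (measurable_pulls j)) measurable_const
  have hmarkov := (mul_meas_ge_le_lintegral (μ := historyLaw σ θ π t)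
    (measurable_pseudoRegret θ).ennreal_ofReal (ENNReal.ofReal (2 * B))).trans hE
  have hc : (historyLaw σ θ π t).real {h : History K t | (pulls h j : ℝ) ≤ 2 * B / Δ}ᶜ ≤ 1 / 2 := by
    have h1 := ENNReal.toReal_mono (by finiteness) hmarkov
    rw [ENNReal.toReal_mul, ENNReal.toReal_ofReal hB.le, ENNReal.toReal_ofReal (by positivity)]
      at h1
    have h2 := measureReal_mono (μ := historyLaw σ θ π t) hcomp
    have h3 : (historyLaw σ θ π t).real
      {h | ENNReal.ofReal (2 * B) ≤ ENNReal.ofReal (pseudoRegret θ h)} ≤ 1 / 2 := by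
      rw [measureReal_def]
      nlinarith
    exact h2.trans h3
  have hP : (1 / 2 : ℝ) ≤ (historyLaw σ θ π t).real {h | (pulls h j : ℝ) ≤ 2 * B / Δ} := by
    rw [probReal_compl_eq_one_sub hA] at hc
    linarith
  have hmain := historyLaw_shift_ge hσ θ j (2 * Δ) (2 * B / Δ) π t hP
  have hexp : 2 * B / Δ * ((2 * Δ) ^ 2 / (σ : ℝ) ^ 2) = 8 * Δ * B / (σ : ℝ) ^ 2 := by
    field_simp
    ring
  rw [hexp] at hmain
  refine (ENNReal.ofReal_le_ofReal hmain).trans ?_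
  rw [ofReal_measureReal]
  refine measure_mono fun h hh => ?_
  -- In the new instance `j` has mean `2Δ`, `i` has `Δ` and the rest `0`.
  have hreg := le_pseudoRegret_of_forall_ne (θ + Pi.single j (2 * Δ)) h j (Δ := Δ) fun l hl => by
    refine le_trans ?_ (sub_le_gap _ j l)
    by_cases hli : l = i
    · subst hli
      simp [hθ, hij]
      linarith
    · simp [hθ, hij.symm, hl, hli]
      linarith
  have h1 : (pulls h j : ℝ) * Δ ≤ 2 * B := by
    have := (le_div_iff₀ hΔ).1 (show (pulls h j : ℝ) ≤ 2 * B / Δ from hh)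
    exact this
  change x < _
  nlinarith

theorem pseudoRegret_le_snoc {K t : ℕ} (θ : Fin K → ℝ) (h : History K t) (y : Fin K × ℝ) :
    pseudoRegret θ h ≤ pseudoRegret θ (Fin.snoc h y : History K (t + 1)) := by
  refine Finset.sum_le_sum fun k _ => mul_le_mul_of_nonneg_right ?_ (gap_nonneg θ k)
  simp only [pulls, Finset.card_filter, Fin.sum_univ_castSucc, Fin.snoc_castSucc]
  exact_mod_cast Nat.le_add_right _ _

/-- One policy serves all `t`, so each law extends the previous one by a round, and a round never
lowers the regret. This is where any-time matters. -/
theorem monotone_historyLaw_pseudoRegret {K : ℕ} (σ : ℝ≥0) (θ : Fin K → ℝ) (π : AnyTimePolicy K)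
    (x : ℝ) : Monotone fun t => historyLaw σ θ π t {h | x < pseudoRegret θ h} := by
  refine monotone_nat_of_le_succ fun t => ?_
  have hm : ∀ n, MeasurableSet {h : History K n | x < pseudoRegret θ h} := fun n =>
    measurableSet_lt measurable_const (measurable_pseudoRegret θ)
  rw [← lintegral_indicator_one (hm t), ← lintegral_indicator_one (hm (t + 1)),
    lintegral_historyLaw_succ _ _ _ _ (measurable_one.indicator (hm (t + 1)))]
  refine lintegral_mono fun h => ?_
  by_cases hh : x < pseudoRegret θ h
  · have : ∀ y, Set.indicator {h : History K (t + 1) | x < pseudoRegret θ h}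
        (1 : History K (t + 1) → ℝ≥0∞) (Fin.snoc h y) = 1 := fun y => by
      simp [hh.trans_le (pseudoRegret_le_snoc θ h y)]
    simp [this, hh]
  · simp [hh]

end Bandit

/-! ### Asymptotic comparison of powers of `T`. -/

theorem eventually_const_mul_rpow_le {s γ : ℝ} (hs : s < γ) (a : ℝ) {b : ℝ} (hb : 0 < b) :
    ∀ᶠ T : ℕ in atTop, a * (T : ℝ) ^ s ≤ b * (T : ℝ) ^ γ := by
  have h := ((tendsto_rpow_atTop (sub_pos.2 hs)).comp
    tendsto_natCast_atTop_atTop).eventually_ge_atTop (a / b)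
  filter_upwards [h, eventually_gt_atTop 0] with T hT hT0
  have hT0' : (0 : ℝ) < T := by exact_mod_cast hT0
  have hT' : a / b ≤ (T : ℝ) ^ (γ - s) := hT
  rw [div_le_iff₀ hb] at hT'
  calc a * (T : ℝ) ^ s ≤ ((T : ℝ) ^ (γ - s) * b) * (T : ℝ) ^ s :=
        mul_le_mul_of_nonneg_right hT' (by positivity)
    _ = b * ((T : ℝ) ^ (γ - s) * (T : ℝ) ^ s) := by ring
    _ = b * (T : ℝ) ^ γ := by rw [← Real.rpow_add hT0', sub_add_cancel]

theorem not_limsup_log_div_rpow_le {f : ℕ → ℝ≥0∞} {a s γ C : ℝ} (hγ : 0 < γ) (hs : s < γ)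
    (hC : 0 < C)
    (hf : ∀ᶠ T : ℕ in atTop, ENNReal.ofReal (Real.exp (-(a * (T : ℝ) ^ s)) / 4) ≤ f T) :
    ¬ limsup (fun T : ℕ => ENNReal.log (f T) / (((T : ℝ) ^ γ : ℝ) : EReal)) atTop ≤
      ((-C : ℝ) : EReal) := by
  intro hlim
  have hlt : ((-C : ℝ) : EReal) < ((-(C / 2) : ℝ) : EReal) := by
    rw [EReal.coe_lt_coe_iff]
    linarith
  have hev := eventually_lt_of_limsup_lt (hlim.trans_lt hlt)
  -- The exponent `a * T ^ s` and the `log 4` from the prefactor each take at most `C / 4` of the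
  -- rate; together they contradict decay at rate `C / 2`.
  obtain ⟨T, h1, h2, h3, h4, hT⟩ := (hev.and (hf.and
    ((eventually_const_mul_rpow_le hs a (b := C / 4) (by positivity)).and
    ((eventually_const_mul_rpow_le hγ (Real.log 4) (b := C / 4) (by positivity)).and
      (eventually_gt_atTop 0))))).exists
  have hT0 : (0 : ℝ) < (T : ℝ) ^ γ := Real.rpow_pos_of_pos (by exact_mod_cast hT) _
  rw [EReal.div_lt_iff (by exact_mod_cast hT0) (EReal.coe_ne_top _), ← EReal.coe_mul] at h1
  have h5 := (ENNReal.log_le_log h2).trans_lt h1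
  rw [ENNReal.log_ofReal_of_pos (by positivity), EReal.coe_lt_coe_iff,
    Real.log_div (Real.exp_ne_zero _) (by norm_num), Real.log_exp] at h5
  rw [Real.rpow_zero] at h4
  linarith

theorem eventually_le_ofReal_rpow_of_limsup_div_eq_zero {f : ℕ → ℝ≥0∞} {s : ℝ}
    (hf : limsup (fun T : ℕ => f T / (T : ℝ≥0∞) ^ s) atTop = 0) :
    ∀ᶠ T : ℕ in atTop, f T ≤ ENNReal.ofReal ((T : ℝ) ^ s) := by
  have h := eventually_lt_of_limsup_lt (hf.trans_lt one_pos)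
  filter_upwards [h, eventually_gt_atTop 0] with T hT hT0
  have hT0' : (0 : ℝ) < T := by exact_mod_cast hT0
  rw [← ENNReal.ofReal_rpow_of_pos hT0', ENNReal.ofReal_natCast]
  have h0 : ((T : ℝ≥0∞) ^ s) ≠ 0 := by
    rw [← ENNReal.ofReal_natCast, ENNReal.ofReal_rpow_of_pos hT0']
    exact (ENNReal.ofReal_pos.2 (by positivity)).ne'
  have htop : ((T : ℝ≥0∞) ^ s) ≠ ∞ := by
    rw [← ENNReal.ofReal_natCast, ENNReal.ofReal_rpow_of_pos hT0']
    exact ENNReal.ofReal_ne_top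
  have := (ENNReal.div_le_iff h0 htop).1 hT.le
  rwa [one_mul] at this

/-! ### The three impossibility results. -/

namespace Bandit

theorem single_mem_meanVectors {K : ℕ} (i : Fin K) {Δ : ℝ} (h0 : 0 ≤ Δ) (h1 : Δ ≤ 1) :
    (Pi.single i Δ : Fin K → ℝ) ∈ meanVectors K := by
  refine ⟨Pi.single_nonneg.2 h0, fun k => ?_⟩
  rcases eq_or_ne k i with rfl | hk
  · simpa using h1
  · simp [hk]

theorem single_add_single_mem_meanVectors {K : ℕ} {i j : Fin K} (hij : i ≠ j) {Δ Δ' : ℝ}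
    (h0 : 0 ≤ Δ) (h1 : Δ ≤ 1) (h0' : 0 ≤ Δ') (h1' : Δ' ≤ 1) :
    (Pi.single i Δ + Pi.single j Δ' : Fin K → ℝ) ∈ meanVectors K := by
  refine ⟨add_nonneg (Pi.single_nonneg.2 h0) (Pi.single_nonneg.2 h0'), fun k => ?_⟩
  rcases eq_or_ne k i with rfl | hk
  · simpa [hij] using h1
  · simpa [hk] using (single_mem_meanVectors j h0' h1').2 k

theorem not_isWorstCaseTailed_of_isOptimal {K : ℕ} {σ : ℝ≥0} (hσ : 0 < σ) {i j : Fin K}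
    (hij : i ≠ j) {α δ γ : ℝ} (hα : 1 / 2 ≤ α) (π : FixedTimePolicy K) (hπ : IsOptimal σ α π)
    (hδ : α < δ) (hδ1 : δ ≤ 1) (hγ : δ + α - 1 < γ) : ¬ IsWorstCaseTailed σ δ γ π := by
  rintro ⟨c, C, -, hc, hC, hlim⟩
  -- `α' < δ` makes `2 * T ^ α'` negligible against `T ^ δ`; the other bound gives `δ - 1 + α' < γ`.
  obtain ⟨α', hα', hα''⟩ := exists_between (lt_min hδ (by linarith : α < γ + 1 - δ))
  obtain ⟨h1, h2⟩ := lt_min_iff.1 hα''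
  refine not_limsup_log_div_rpow_le (a := 4 / (σ : ℝ) ^ 2) (s := δ - 1 + α') (by linarith)
    (by linarith) hC ?_ hlim
  filter_upwards [eventually_le_ofReal_rpow_of_limsup_div_eq_zero (hπ α' hα'),
    eventually_const_mul_rpow_le h1 4 (b := 1 / 2 - c) (by linarith),
    eventually_gt_atTop 0] with T hT hTδ hT0
  have hT0' : (0 : ℝ) < T := by exact_mod_cast hT0
  have hΔ : 0 < (T : ℝ) ^ (δ - 1) := by positivity
  have hΔ1 : (T : ℝ) ^ (δ - 1) ≤ 1 :=
    Real.rpow_le_one_of_one_le_of_nonpos (by exact_mod_cast hT0) (by linarith)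
  have hmem := single_mem_meanVectors i (Δ := (T : ℝ) ^ (δ - 1) / 2) (by positivity) (by linarith)
  have hmem' := single_add_single_mem_meanVectors hij (Δ := (T : ℝ) ^ (δ - 1) / 2)
    (Δ' := 2 * ((T : ℝ) ^ (δ - 1) / 2)) (by positivity) (by linarith) (by positivity) (by linarith)
  have hTT : (T : ℝ) * (T : ℝ) ^ (δ - 1) = (T : ℝ) ^ δ := by
    rw [← Real.rpow_one_add' hT0'.le (by linarith), add_sub_cancel]
  have hB : 0 < (T : ℝ) ^ α' := by positivity
  -- Here `T * Δ = T ^ δ / 2`, which is why `c < 1 / 2` is what is needed.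
  have key := historyLaw_pseudoRegret_ge hσ hij (π T) T (x := c * (T : ℝ) ^ δ) (half_pos hΔ) hB
    ((le_iSup₂ (f := fun θ (_ : θ ∈ meanVectors K) => expectedRegret σ π θ T) _ hmem).trans hT)
    (by linarith)
  refine (le_of_eq ?_).trans (key.trans (le_iSup₂
    (f := fun θ (_ : θ ∈ meanVectors K) => regretTail σ π θ T (c * (T : ℝ) ^ δ)) _ hmem'))
  congr 4
  rw [Real.rpow_add hT0']
  ring

/-- A consistent policy has linear regret with a probability that is not too small when the arm `j`
with mean `1` is the best and the arm `i` with mean `1 / 2` the second best. -/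
theorem eventually_historyLaw_pseudoRegret_ge {K : ℕ} {σ : ℝ≥0} (hσ : 0 < σ) {i j : Fin K}
    (hij : i ≠ j) {β β' c : ℝ} (hβ' : β < β') (hβ1 : β' < 1) (hc : c < 1 / 2)
    (π : FixedTimePolicy K) (hπ : IsConsistent σ β π) :
    ∀ᶠ t : ℕ in atTop, ENNReal.ofReal (Real.exp (-(4 / (σ : ℝ) ^ 2 * (t : ℝ) ^ β')) / 4) ≤
      historyLaw σ (Pi.single i (1 / 2) + Pi.single j 1) (π t) t
        {h | c * t < pseudoRegret (Pi.single i (1 / 2) + Pi.single j 1) h} := by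
  have hmem := single_mem_meanVectors i (Δ := 1 / 2) (by norm_num) (by norm_num)
  filter_upwards [eventually_le_ofReal_rpow_of_limsup_div_eq_zero (hπ _ hmem β' hβ'),
    eventually_const_mul_rpow_le hβ1 4 (b := 1 / 2 - c) (by linarith),
    eventually_gt_atTop 0] with t ht htβ ht0
  have ht0' : (0 : ℝ) < t := by exact_mod_cast ht0
  have hB : 0 < (t : ℝ) ^ β' := by positivity
  rw [Real.rpow_one] at htβ
  have key := historyLaw_pseudoRegret_ge hσ hij (π t) t (x := c * t) (by norm_num) hB ht
    (by linarith)
  rw [mul_one_div_cancel two_ne_zero] at key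
  refine (le_of_eq ?_).trans key
  congr 4
  ring

theorem not_isInstanceTailed_of_isConsistent {K : ℕ} {σ : ℝ≥0} (hσ : 0 < σ) {i j : Fin K}
    (hij : i ≠ j) {β δ γ : ℝ} (hβ : 0 ≤ β) (hβ1 : β < 1) (π : FixedTimePolicy K)
    (hπ : IsConsistent σ β π) (hδ1 : δ ≤ 1) (hγ : β < γ) : ¬ IsInstanceTailed σ δ γ π := by
  intro htail
  obtain ⟨c, C, hc0, hc, hC, hlim⟩ := htail _ (single_add_single_mem_meanVectors hij (Δ := 1 / 2)
    (Δ' := 1) (by norm_num) (by norm_num) (by norm_num) le_rfl)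
  obtain ⟨β', hβ', hβ''⟩ := exists_between (lt_min hβ1 hγ)
  obtain ⟨h1, h2⟩ := lt_min_iff.1 hβ''
  refine not_limsup_log_div_rpow_le (a := 4 / (σ : ℝ) ^ 2) (by linarith) h2 hC ?_ hlim
  filter_upwards [eventually_historyLaw_pseudoRegret_ge hσ hij hβ' h1 hc π hπ,
    eventually_gt_atTop 0] with T hT hT0
  refine hT.trans (measure_mono fun h hh => ?_)
  refine lt_of_le_of_lt (mul_le_mul_of_nonneg_left ?_ hc0.le) (show c * T < _ from hh)
  simpa using Real.rpow_le_rpow_of_exponent_le (x := (T : ℝ)) (by exact_mod_cast hT0) hδ1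

theorem not_isInstanceTailed_toFixedTime_of_isConsistent {K : ℕ} {σ : ℝ≥0} (hσ : 0 < σ)
    {i j : Fin K} (hij : i ≠ j) {β δ γ : ℝ} (hβ : 0 ≤ β) (hβ1 : β < 1) (π : AnyTimePolicy K)
    (hπ : IsConsistent σ β π.toFixedTime) (hδ : 0 < δ) (hδ1 : δ ≤ 1) (hγ : δ * β < γ) :
    ¬ IsInstanceTailed σ δ γ π.toFixedTime := by
  intro htail
  obtain ⟨c, C, hc0, hc, hC, hlim⟩ := htail _ (single_add_single_mem_meanVectors hij (Δ := 1 / 2)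
    (Δ' := 1) (by norm_num) (by norm_num) (by norm_num) le_rfl)
  obtain ⟨β', hβ', hβ''⟩ := exists_between (lt_min hβ1 ((lt_div_iff₀' hδ).2 hγ))
  obtain ⟨h1, h2⟩ := lt_min_iff.1 hβ''
  have hγ0 : 0 < γ := (mul_nonneg hδ.le hβ).trans_lt hγ
  refine not_limsup_log_div_rpow_le (a := 4 / (σ : ℝ) ^ 2 * 2 ^ β') (s := δ * β') hγ0
    ((lt_div_iff₀' hδ).1 h2) hC ?_ hlim
  -- Linear regret at round `⌈T ^ δ⌉₊` already exceeds `c * T ^ δ`. Rounding up at most doubles `T ^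
  -- δ`, whence the factor `2 ^ β'`.
  have hceil : Tendsto (fun T : ℕ => ⌈(T : ℝ) ^ δ⌉₊) atTop atTop :=
    tendsto_nat_ceil_atTop.comp ((tendsto_rpow_atTop hδ).comp tendsto_natCast_atTop_atTop)
  filter_upwards [hceil.eventually
    (eventually_historyLaw_pseudoRegret_ge hσ hij hβ' h1 hc π.toFixedTime hπ),
    eventually_gt_atTop 0] with T hT hT0
  have hT1 : (1 : ℝ) ≤ T := by exact_mod_cast hT0
  have hle : (T : ℝ) ^ δ ≤ ⌈(T : ℝ) ^ δ⌉₊ := Nat.le_ceil _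
  have hle2 : (⌈(T : ℝ) ^ δ⌉₊ : ℝ) ≤ 2 * (T : ℝ) ^ δ := by
    have := Nat.ceil_lt_add_one (a := (T : ℝ) ^ δ) (by positivity)
    linarith [Real.one_le_rpow hT1 hδ.le]
  have hleT : ⌈(T : ℝ) ^ δ⌉₊ ≤ T :=
    Nat.ceil_le.2 (by simpa using Real.rpow_le_rpow_of_exponent_le hT1 hδ1)
  refine (ENNReal.ofReal_le_ofReal ?_).trans (hT.trans
    ((measure_mono fun h hh => ?_).trans (monotone_historyLaw_pseudoRegret σ _ π _ hleT)))
  · have hpow : (⌈(T : ℝ) ^ δ⌉₊ : ℝ) ^ β' ≤ 2 ^ β' * (T : ℝ) ^ (δ * β') := by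
      rw [Real.rpow_mul (by positivity), ← Real.mul_rpow (by norm_num) (by positivity)]
      exact Real.rpow_le_rpow (by positivity) hle2 (by linarith)
    rw [mul_assoc]
    gcongr
  · exact lt_of_le_of_lt (mul_le_mul_of_nonneg_left hle hc0.le) hh

end Bandit

theorem mainTheorem5 (K : ℕ) (hK : 2 ≤ K) (σ : ℝ≥0) (hσ : 0 < σ) :
    (∀ α : ℝ, 1 / 2 ≤ α → α < 1 → ∀ π : Bandit.FixedTimePolicy K, Bandit.IsOptimal σ α π →
      ∀ δ γ : ℝ, α < δ → δ ≤ 1 → δ + α - 1 < γ → ¬ Bandit.IsWorstCaseTailed σ δ γ π) ∧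
    (∀ β : ℝ, 0 ≤ β → β < 1 → ∀ π : Bandit.FixedTimePolicy K, Bandit.IsConsistent σ β π →
      ∀ δ γ : ℝ, β < δ → δ ≤ 1 → β < γ → ¬ Bandit.IsInstanceTailed σ δ γ π) ∧
    (∀ β : ℝ, 0 ≤ β → β < 1 → ∀ π : Bandit.AnyTimePolicy K,
      Bandit.IsConsistent σ β π.toFixedTime →
      ∀ δ γ : ℝ, β < δ → δ ≤ 1 → δ * β < γ →
        ¬ Bandit.IsInstanceTailed σ δ γ π.toFixedTime) := by
  have hij : (⟨0, by omega⟩ : Fin K) ≠ ⟨1, by omega⟩ := by simp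
  refine ⟨fun α hα _ π hπ δ γ hδ hδ1 hγ => ?_, fun β hβ hβ1 π hπ δ γ _ hδ1 hγ => ?_,
    fun β hβ hβ1 π hπ δ γ hδ hδ1 hγ => ?_⟩
  · exact Bandit.not_isWorstCaseTailed_of_isOptimal hσ hij hα π hπ hδ hδ1 hγ
  · exact Bandit.not_isInstanceTailed_of_isConsistent hσ hij hβ hβ1 π hπ hδ1 hγ
  · exact Bandit.not_isInstanceTailed_toFixedTime_of_isConsistent hσ hij hβ hβ1 π hπ
      (hβ.trans_lt hδ) hδ1 hγ
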